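/- Let $p,q\ge 1$ and $s\ge 3$ be integers, let $x_1,\dots,x_s$ be distinct points of $\mathbb{P}^1(\mathbb{C})$, put $D=x_1+\dots+x_s$, let $\mathcal K$ be the canonical bundle of $\mathbb{P}^1$, and let $a\in\mathbb{Z}$. Let $\alpha^j,\beta^j\in[0,1)$ ($1\le j\le s$) be real numbers such that $\alpha^j<\beta^j$ and $p\alpha^j+q\beta^j\in\mathbb{Z}$ for all $j$, such that $\epsilon:=\sum_j(\beta^j-\alpha^j)$ satisfies $$\epsilon<1\quad\text{and}\quad (2pq-p-q)\,\epsilon>2pq-2p-2q,$$ and such that $p\sum_j\alpha^j+q\sum_j\beta^j=(p+q)a-p$. Let $\mathcal U_\bullet$ be the bundle $\mathcal U=\mathbb{C}^p\otimes\mathcal O(-a+1)$ with, at each $x_j$, the trivial flag with the single weight $\alpha^j$ (of multiplicity $p$), and let $\mathcal V_\bullet$ be the bundle $\mathcal V=\mathbb{C}^q\otimes\mathcal O(-a)$ with, at each $x_j$, the trivial flag with the single weight $\beta^j$ (of multiplicity $q$). Fix a basis $b_1,\dots,b_{s-2}$ of $H^0(\mathcal O(s-3))$. For $\mathbf A=(A_1,\dots,A_{s-2})\in\mathrm{Hom}(\mathbb{C}^p,\mathbb{C}^q)^{s-2}$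 let $\gamma_{\mathbf A}=\sum_j A_j\otimes b_j$, a section of $\mathcal K(D)\otimes\mathrm{Hom}(\mathcal U,\mathcal V)\cong\mathrm{Hom}(\mathbb{C}^p,\mathbb{C}^q)\otimes\mathcal O(s-3)$. The parabolic $\mathrm{SU}(p,q)$ Higgs bundle $(\mathcal U_\bullet\oplus\mathcal V_\bullet,\gamma_{\mathbf A}\oplus 0)$ is called semistable if $\deg(\mathcal U'_\bullet)+\deg(\mathcal V'_\bullet)\le 0$ for all holomorphic sub-bundles $\mathcal U'\subset\mathcal U$, $\mathcal V'\subset\mathcal V$ with $\gamma_{\mathbf A}(\mathcal U')\subset\mathcal K(D)\otimes\mathcal V'$, where $\deg$ is the parabolic degree (the degree plus the sum of all weights, counted with multiplicity) for the induced parabolic structures; it is called stable if this inequality is strict whenever $\mathcal U'\oplus\mathcal V'$ is neither $0$ nor $\mathcal U\oplus\mathcal V$. Then: 1. $(\mathcal U_\bullet\oplus\mathcal V_\bullet,\gamma_{\mathbf A}\oplus 0)$ is semistable if and only if $\dim V'\ge\frac qp\dim U'$ for all linear subspaces $U'\subset\mathbb{C}^p$, $V'\subset\mathbb{C}^q$ with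 $A_j(U')\subset V'$ for all $j$. 2. $(\mathcal U_\bullet\oplus\mathcal V_\bullet,\gamma_{\mathbf A}\oplus 0)$ is stable if and only if, moreover, equality $\dim V'=\frac qp\dim U'$ for such a pair holds only when $U'=0,\ V'=0$ or when $U'=\mathbb{C}^p,\ V'=\mathbb{C}^q$. -/

import Mathlib

/-!
Parabolic `SU(p,q)` Higgs bundles over the punctured Riemann sphere and the Kronecker space
`Hom(ℂ^p, ℂ^q)^r`.

The Riemann sphere is `OnePoint ℂ`, with the coordinate `z` on `ℂ` and the coordinate `w = 1 / z`
around `∞`.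
-/

noncomputable section

namespace ParHiggs

/-- A holomorphic vector bundle of rank `r` over the Riemann sphere, obtained by gluing the trivial
bundles over the two affine charts along `ℂ ∖ {0}` (every holomorphic vector bundle over the sphere
arises in this way, since holomorphic vector bundles over `ℂ` are trivial).
A section is a pair `(f₀, f∞)` with `f∞ (1 / z) = T z * f₀ z` for `z ≠ 0`. -/
structure HolBundle (r : ℕ) where
  T : ℂ → Matrix (Fin r) (Fin r) ℂ
  holo : ∀ i j, DifferentiableOn ℂ (fun z => T z i j) {0}ᶜ
  det_ne_zero : ∀ z, z ≠ 0 → (T z).det ≠ 0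

/-- The degree of a bundle, i.e. the degree of its determinant line bundle: minus the winding number
of the transition function `det T` around `0`. -/
def HolBundle.degree {r : ℕ} (E : HolBundle r) : ℝ :=
  (-(2 * (Real.pi : ℂ) * Complex.I)⁻¹ *
    circleIntegral (logDeriv fun z => (E.T z).det) 0 1).re

/-- The bundle `ℂ^r ⊗ 𝒪(n)`: its sections are the pairs with `f∞ w = w ^ n • f₀ (1 / w)`. -/
def twist (r : ℕ) (n : ℤ) : HolBundle r where
  T z := z ^ (-n) • (1 : Matrix (Fin r) (Fin r) ℂ)
  holo i j := by
    intro z hz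
    have hz' : z ≠ 0 := hz
    simp only [Matrix.smul_apply, smul_eq_mul]
    exact ((differentiableAt_zpow.2 (Or.inl hz')).mul_const _).differentiableWithinAt
  det_ne_zero z hz := by
    rw [Matrix.det_smul, Matrix.det_one, mul_one]
    exact pow_ne_zero _ (zpow_ne_zero _ hz)

/-- A holomorphic sub-bundle of rank `m`: a bundle of rank `m` with a holomorphic bundle morphism
into `E` that is injective on every fibre. -/
structure Subbundle {r : ℕ} (E : HolBundle r) (m : ℕ) where
  bundle : HolBundle m
  incl₀ : ℂ → Matrix (Fin r) (Fin m) ℂ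
  inclInf : ℂ → Matrix (Fin r) (Fin m) ℂ
  holo₀ : ∀ i j, Differentiable ℂ fun z => incl₀ z i j
  holoInf : ∀ i j, Differentiable ℂ fun w => inclInf w i j
  compat : ∀ z, z ≠ 0 → inclInf z⁻¹ * bundle.T z = E.T z * incl₀ z
  inj₀ : ∀ z, Function.Injective (incl₀ z).mulVecLin
  injInf : ∀ w, Function.Injective (inclInf w).mulVecLin

/-- The inclusion of the fibres at a point `x` of the sphere. The fibre of a bundle of rank `r` is
identified with `ℂ^r` by the first trivialization if `x ∈ ℂ` and by the second one if `x = ∞`. -/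
def Subbundle.fibreMap {r m : ℕ} {E : HolBundle r} (F : Subbundle E m) (x : OnePoint ℂ) :
    (Fin m → ℂ) →ₗ[ℂ] (Fin r → ℂ) :=
  x.elim (F.inclInf 0).mulVecLin fun z => (F.incl₀ z).mulVecLin

theorem Subbundle.fibreMap_injective {r m : ℕ} {E : HolBundle r} (F : Subbundle E m)
    (x : OnePoint ℂ) : Function.Injective (F.fibreMap x) := by
  induction x using OnePoint.rec with
  | infty => exact F.injInf 0
  | coe z => exact F.inj₀ z

/-- A weighted flag with weights in `[0, 1)` in a vector space, written as a decreasing and left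
continuous filtration indexed by the weights. -/
structure WeightedFlag (W : Type) [AddCommGroup W] [Module ℂ W] where
  filt : ℝ → Submodule ℂ W
  anti : Antitone filt
  leftCont : ∀ t, ∃ ε > 0, filt (t - ε) = filt t
  filt_zero : filt 0 = ⊤
  filt_one : filt 1 = ⊥

/-- The step of the filtration just after `t`. -/
def WeightedFlag.after {W : Type} [AddCommGroup W] [Module ℂ W] (f : WeightedFlag W) (t : ℝ) :
    Submodule ℂ W :=
  ⨆ u ∈ Set.Ioi t, f.filt u

/-- The sum of the weights, i.e. of the jumps of the filtration, counted with multiplicity. -/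
def WeightedFlag.totalWeight {W : Type} [AddCommGroup W] [Module ℂ W] (f : WeightedFlag W) : ℝ :=
  ∑ᶠ t : ℝ, t * ((Module.finrank ℂ (f.filt t) : ℝ) - Module.finrank ℂ (f.after t))

/-- The flag induced on a subspace, given by an injective linear map. -/
def WeightedFlag.comap {W W' : Type} [AddCommGroup W] [Module ℂ W] [AddCommGroup W'] [Module ℂ W']
    (f : WeightedFlag W) (i : W' →ₗ[ℂ] W) (hi : Function.Injective i) : WeightedFlag W' where
  filt t := (f.filt t).comap i
  anti _ _ h := Submodule.comap_mono (f.anti h)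
  leftCont t := by
    obtain ⟨ε, hε, h⟩ := f.leftCont t
    exact ⟨ε, hε, by rw [h]⟩
  filt_zero := by rw [f.filt_zero, Submodule.comap_top]
  filt_one := by rw [f.filt_one, Submodule.comap_bot, LinearMap.ker_eq_bot.2 hi]

/-- The trivial flag with the single weight `c ∈ [0, 1)`. -/
def constFlag (W : Type) [AddCommGroup W] [Module ℂ W] (c : ℝ) (h0 : 0 ≤ c) (h1 : c < 1) :
    WeightedFlag W where
  filt t := if t ≤ c then ⊤ else ⊥
  anti t u h := by
    by_cases hu : u ≤ c
    · simp [hu, h.trans hu]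
    · simp [hu]
  leftCont t := by
    by_cases ht : t ≤ c
    · exact ⟨1, one_pos, by simp [ht, show t - 1 ≤ c by linarith]⟩
    · refine ⟨(t - c) / 2, by linarith, ?_⟩
      simp only [ht, if_false, ite_eq_right_iff]
      intro h
      exact absurd h (by linarith)
  filt_zero := by simp [h0]
  filt_one := by simp [h1]

theorem constFlag_after {W : Type} [AddCommGroup W] [Module ℂ W] (c : ℝ) (h0 : 0 ≤ c)
    (h1 : c < 1) (t : ℝ) :
    (constFlag W c h0 h1).after t = if t < c then ⊤ else ⊥ := by
  unfold WeightedFlag.after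
  by_cases h : t < c
  · rw [if_pos h, eq_top_iff]
    refine le_iSup₂_of_le c h ?_
    simp [constFlag]
  · rw [if_neg h, eq_bot_iff]
    refine iSup₂_le fun u hu => ?_
    have : ¬ u ≤ c := fun h' => h (lt_of_lt_of_le hu h')
    simp [constFlag, this]

theorem constFlag_totalWeight (r : ℕ) (c : ℝ) (h0 : 0 ≤ c) (h1 : c < 1) :
    (constFlag (Fin r → ℂ) c h0 h1).totalWeight = r * c := by
  have hf : ∀ t, (constFlag (Fin r → ℂ) c h0 h1).filt t = if t ≤ c then ⊤ else ⊥ := fun _ => rfl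
  unfold WeightedFlag.totalWeight
  rw [finsum_eq_single _ c]
  · rw [constFlag_after, hf, if_pos le_rfl, if_neg (lt_irrefl c)]
    simp [mul_comm]
  · intro t ht
    rw [constFlag_after, hf]
    rcases lt_or_gt_of_ne ht with h | h
    · rw [if_pos h, if_pos h.le, sub_self, mul_zero]
    · rw [if_neg (not_lt.2 h.le), if_neg (not_le.2 h), sub_self, mul_zero]

/-- A parabolic bundle of rank `r` over the sphere punctured at the points `x j`: a holomorphic
vector bundle with a weighted flag in the fibre over each puncture. -/
structure ParBundle {s : ℕ} (x : Fin s → OnePoint ℂ) (r : ℕ) extends HolBundle r where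
  flag : Fin s → WeightedFlag (Fin r → ℂ)

/-- The parabolic degree. -/
def ParBundle.parDegree {s r : ℕ} {x : Fin s → OnePoint ℂ} (E : ParBundle x r) : ℝ :=
  E.toHolBundle.degree + ∑ j, (E.flag j).totalWeight

/-- A sub-bundle of a parabolic bundle with the induced parabolic structure. -/
def ParBundle.induced {s r m : ℕ} {x : Fin s → OnePoint ℂ} (E : ParBundle x r)
    (F : Subbundle E.toHolBundle m) : ParBundle x m where
  toHolBundle := F.bundle
  flag j := (E.flag j).comap (F.fibreMap (x j)) (F.fibreMap_injective (x j))

/-- `dz / poles₀ x z` generates the line bundle `𝒦(D)`, `D = ∑ j, x j`, over the first chart. -/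
def poles₀ {s : ℕ} (x : Fin s → OnePoint ℂ) (z : ℂ) : ℂ :=
  ∏ j, (x j).elim 1 fun c => z - c

/-- `dw / polesInf x w` generates the line bundle `𝒦(D)`, `D = ∑ j, x j`, over the chart around
`∞`; a puncture `c ≠ 0` in `ℂ` has the coordinate `w = 1 / c`, and the puncture `∞` has `w = 0`. -/
def polesInf {s : ℕ} (x : Fin s → OnePoint ℂ) (w : ℂ) : ℂ :=
  ∏ j, (x j).elim w fun c => if c = 0 then 1 else w - c⁻¹

/-- A holomorphic section of `𝒦(D) ⊗ Hom(E, F)`. It is `(dz / poles₀ x z) • coeff₀ z` over the first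
chart and `(dw / polesInf x w) • coeffInf w` over the second one; these agree for `z ≠ 0`,
where `w = 1 / z` and `dw = -dz / z ^ 2`. -/
structure LogHom {s p q : ℕ} (x : Fin s → OnePoint ℂ) (E : HolBundle p) (F : HolBundle q) where
  coeff₀ : ℂ → Matrix (Fin q) (Fin p) ℂ
  coeffInf : ℂ → Matrix (Fin q) (Fin p) ℂ
  holo₀ : ∀ i j, Differentiable ℂ fun z => coeff₀ z i j
  holoInf : ∀ i j, Differentiable ℂ fun w => coeffInf w i j
  compat : ∀ z, z ≠ 0 →
    (poles₀ x z * -(z ^ 2)⁻¹) • (coeffInf z⁻¹ * E.T z) = polesInf x z⁻¹ • (F.T z * coeff₀ z)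

/-- The value of a section of `𝒦(D) ⊗ Hom(E, F)` at a point, in the local generators of `𝒦(D)`
chosen above. At a puncture this is a nonzero multiple of the residue. -/
def LogHom.fibreMap {s p q : ℕ} {x : Fin s → OnePoint ℂ} {E : HolBundle p} {F : HolBundle q}
    (φ : LogHom x E F) (y : OnePoint ℂ) : (Fin p → ℂ) →ₗ[ℂ] (Fin q → ℂ) :=
  y.elim (φ.coeffInf 0).mulVecLin fun z => (φ.coeff₀ z).mulVecLin

/-- The zero section. -/
def LogHom.zero {s p q : ℕ} (x : Fin s → OnePoint ℂ) (E : HolBundle p) (F : HolBundle q) :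
    LogHom x E F where
  coeff₀ _ := 0
  coeffInf _ := 0
  holo₀ i j := by simp
  holoInf i j := by simp
  compat z _ := by simp

/-- The section is (strongly) parabolic: over each puncture it strictly increases the weights. -/
def IsParabolic {s p q : ℕ} {x : Fin s → OnePoint ℂ} (E : ParBundle x p) (F : ParBundle x q)
    (φ : LogHom x E.toHolBundle F.toHolBundle) : Prop :=
  ∀ j t, ((E.flag j).filt t).map (φ.fibreMap (x j)) ≤ (F.flag j).after t

/-- A parabolic `SU(p,q)` Higgs bundle `(U ⊕ V, γ ⊕ δ)` over the punctured sphere. The last two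
fields say that `det U ⊗ det V` has the trivial parabolic structure and is the trivial line bundle,
that is, of degree `0`. -/
structure SUHiggsBundle {s : ℕ} (x : Fin s → OnePoint ℂ) (p q : ℕ) where
  U : ParBundle x p
  V : ParBundle x q
  γ : LogHom x U.toHolBundle V.toHolBundle
  δ : LogHom x V.toHolBundle U.toHolBundle
  γ_parabolic : IsParabolic U V γ
  δ_parabolic : IsParabolic V U δ
  det_weights : ∀ j, ∃ k : ℤ, (U.flag j).totalWeight + (V.flag j).totalWeight = k
  det_degree : U.parDegree + V.parDegree = 0

namespace SUHiggsBundle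

variable {s p q : ℕ} {x : Fin s → OnePoint ℂ}

/-- The sub-bundle `U' ⊕ V'` is invariant under the Higgs field `γ ⊕ δ`. -/
def Invariant (H : SUHiggsBundle x p q) {m n : ℕ} (U' : Subbundle H.U.toHolBundle m)
    (V' : Subbundle H.V.toHolBundle n) : Prop :=
  ∀ y : OnePoint ℂ,
    (LinearMap.range (U'.fibreMap y)).map (H.γ.fibreMap y) ≤ LinearMap.range (V'.fibreMap y) ∧
    (LinearMap.range (V'.fibreMap y)).map (H.δ.fibreMap y) ≤ LinearMap.range (U'.fibreMap y)

/-- Every invariant sub-bundle `U' ⊕ V'` has parabolic degree `≤ 0`. -/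
def Semistable (H : SUHiggsBundle x p q) : Prop :=
  ∀ (m n : ℕ) (U' : Subbundle H.U.toHolBundle m) (V' : Subbundle H.V.toHolBundle n),
    H.Invariant U' V' → (H.U.induced U').parDegree + (H.V.induced V').parDegree ≤ 0

/-- Every invariant sub-bundle `U' ⊕ V'` other than `0` and `U ⊕ V` has parabolic degree `< 0`. -/
def Stable (H : SUHiggsBundle x p q) : Prop :=
  ∀ (m n : ℕ) (U' : Subbundle H.U.toHolBundle m) (V' : Subbundle H.V.toHolBundle n),
    H.Invariant U' V' → ¬(m = 0 ∧ n = 0) → ¬(m = p ∧ n = q) →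
      (H.U.induced U').parDegree + (H.V.induced V').parDegree < 0

end SUHiggsBundle

/-- King's condition for semistability in `Hom(ℂ^p, ℂ^q)^r`. -/
def KingSemistable {p q r : ℕ} (A : Fin r → (Fin p → ℂ) →ₗ[ℂ] (Fin q → ℂ)) : Prop :=
  ∀ (U' : Submodule ℂ (Fin p → ℂ)) (V' : Submodule ℂ (Fin q → ℂ)),
    (∀ j, U'.map (A j) ≤ V') →
      (q : ℝ) / p * Module.finrank ℂ U' ≤ Module.finrank ℂ V'

/-- King's condition for stability in `Hom(ℂ^p, ℂ^q)^r`. -/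
def KingStable {p q r : ℕ} (A : Fin r → (Fin p → ℂ) →ₗ[ℂ] (Fin q → ℂ)) : Prop :=
  KingSemistable A ∧
    ∀ (U' : Submodule ℂ (Fin p → ℂ)) (V' : Submodule ℂ (Fin q → ℂ)),
      (∀ j, U'.map (A j) ≤ V') →
        (Module.finrank ℂ V' : ℝ) = (q : ℝ) / p * Module.finrank ℂ U' →
          (U' = ⊥ ∧ V' = ⊥) ∨ (U' = ⊤ ∧ V' = ⊤)

/-- The constant `SU(p,q)`-multiweights `(α, β)` under consideration. The number
`ε = ∑ j, (β j - α j)` lies in the interval `((2pq-2p-2q)/(2pq-p-q), 1)`, and `degree_zero` says that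
`ℂ^p ⊗ 𝒪(-a+1) ⊕ ℂ^q ⊗ 𝒪(-a)` with these weights has parabolic degree `0`. -/
structure ConstWeights (p q s : ℕ) (a : ℤ) (α β : Fin s → ℝ) : Prop where
  α_nonneg : ∀ j, 0 ≤ α j
  α_lt_one : ∀ j, α j < 1
  β_nonneg : ∀ j, 0 ≤ β j
  β_lt_one : ∀ j, β j < 1
  integral : ∀ j, ∃ k : ℤ, p * α j + q * β j = k
  lt : ∀ j, α j < β j
  lower : (2 * p * q - 2 * p - 2 * q : ℝ) < (2 * p * q - p - q) * ∑ j, (β j - α j)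
  upper : ∑ j, (β j - α j) < 1
  degree_zero : p * (-a + 1 : ℝ) + q * (-a : ℝ) + (p * ∑ j, α j + q * ∑ j, β j) = 0

/-- `ℂ^r ⊗ 𝒪(n)` with the trivial flag of weight `c j` over the puncture `x j`. -/
def constPar {s : ℕ} (x : Fin s → OnePoint ℂ) (r : ℕ) (n : ℤ) (c : Fin s → ℝ)
    (h0 : ∀ j, 0 ≤ c j) (h1 : ∀ j, c j < 1) : ParBundle x r where
  toHolBundle := twist r n
  flag j := constFlag (Fin r → ℂ) (c j) (h0 j) (h1 j)

theorem twist_degree (r : ℕ) (n : ℤ) : (twist r n).degree = r * n := by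
  have h1 : (fun z : ℂ => ((twist r n).T z).det) = fun z => z ^ (-n * r) := by
    funext z
    simp only [twist, Matrix.det_smul, Matrix.det_one, mul_one, Fintype.card_fin]
    rw [← zpow_natCast, ← zpow_mul]
  have h2 : circleIntegral (logDeriv fun z : ℂ => z ^ (-n * r)) 0 1
      = ((-n * r : ℤ) : ℂ) * (2 * Real.pi * Complex.I) := by
    rw [← circleIntegral.integral_sub_center_inv (0 : ℂ) (one_ne_zero (α := ℝ)),
      ← circleIntegral.integral_const_mul]
    congr 1
    funext z
    rw [logDeriv_apply, deriv_zpow, sub_zero]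
    by_cases hz : z = 0
    · subst hz
      by_cases hk : -n * r = 0
      · simp [hk]
      · rw [zero_zpow _ hk, div_zero, inv_zero, mul_zero]
    · rw [zpow_sub_one₀ hz]
      have := zpow_ne_zero (-n * r) hz
      field_simp
  unfold HolBundle.degree
  rw [h1, h2]
  have hpi : (2 * (Real.pi : ℂ) * Complex.I) ≠ 0 := Complex.two_pi_I_ne_zero
  have : -(2 * (Real.pi : ℂ) * Complex.I)⁻¹ * (((-n * r : ℤ) : ℂ) * (2 * Real.pi * Complex.I))
      = (((r : ℝ) * (n : ℝ) : ℝ) : ℂ) := by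
    push_cast
    field_simp
  rw [this, Complex.ofReal_re]

theorem constPar_parDegree {s : ℕ} (x : Fin s → OnePoint ℂ) (r : ℕ) (n : ℤ) (c : Fin s → ℝ)
    (h0 : ∀ j, 0 ≤ c j) (h1 : ∀ j, c j < 1) :
    (constPar x r n c h0 h1).parDegree = r * n + r * ∑ j, c j := by
  unfold ParBundle.parDegree
  rw [show (constPar x r n c h0 h1).toHolBundle = twist r n from rfl, twist_degree, Finset.mul_sum]
  congr 1
  exact Finset.sum_congr rfl fun j _ => constFlag_totalWeight r (c j) (h0 j) (h1 j)

/-- The constant by which the generators of `𝒦(D)` over the two charts differ. -/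
def transConst {s : ℕ} (x : Fin s → OnePoint ℂ) : ℂ :=
  ∏ j, (x j).elim 1 fun c => if c = 0 then 1 else -c⁻¹

theorem polesInf_inv {s : ℕ} (x : Fin s → OnePoint ℂ) (z : ℂ) (hz : z ≠ 0) :
    polesInf x z⁻¹ * z ^ s = transConst x * poles₀ x z := by
  have hs : z ^ s = ∏ _j : Fin s, z := by simp
  rw [hs, polesInf, transConst, poles₀, ← Finset.prod_mul_distrib, ← Finset.prod_mul_distrib]
  refine Finset.prod_congr rfl fun j _ => ?_
  induction x j using OnePoint.rec with
  | infty => simp [hz]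
  | coe c =>
    by_cases hc : c = 0
    · simp [hc]
    · simp only [OnePoint.elim_some, hc, if_false]
      field_simp
      ring

theorem reflect_eval {s : ℕ} (P : Polynomial ℂ) (hP : P ∈ Polynomial.degreeLT ℂ (s - 2))
    (hs : 3 ≤ s) (z : ℂ) (hz : z ≠ 0) :
    (P.reflect (s - 3)).eval z⁻¹ * z ^ (s - 3) = P.eval z := by
  have hd : P.natDegree ≤ s - 3 := by
    rw [Polynomial.mem_degreeLT] at hP
    rw [Polynomial.natDegree_le_iff_degree_le]
    by_cases h : P = 0
    · simp [h]
    · rw [Polynomial.degree_eq_natDegree h] at hP ⊢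
      have : P.natDegree < s - 2 := by exact_mod_cast hP
      exact_mod_cast (by omega : P.natDegree ≤ s - 3)
  let := invertibleOfNonzero hz
  have := Polynomial.eval₂_reflect_mul_pow (RingHom.id ℂ) z (s - 3) P hd
  simpa [Polynomial.eval₂_id, invOf_eq_inv] using this

/-- The section `γ_A = ∑ j, A_j ⊗ b_j` of `𝒦(D) ⊗ Hom(ℂ^p ⊗ 𝒪(-a+1), ℂ^q ⊗ 𝒪(-a))`, which is
`Hom(ℂ^p, ℂ^q) ⊗ 𝒪(s-3)`, attached to a basis `b` of the space `H⁰(𝒪(s-3))` of polynomials of degree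
at most `s - 3`. -/
def gammaA {p q s : ℕ} (x : Fin s → OnePoint ℂ) (a : ℤ)
    (b : Module.Basis (Fin (s - 2)) ℂ (Polynomial.degreeLT ℂ (s - 2)))
    (A : Fin (s - 2) → (Fin p → ℂ) →ₗ[ℂ] (Fin q → ℂ)) :
    LogHom x (twist p (-a + 1)) (twist q (-a)) where
  coeff₀ z := ∑ j, (b j : Polynomial ℂ).eval z • LinearMap.toMatrix' (A j)
  coeffInf w := -transConst x •
    ∑ j, ((b j : Polynomial ℂ).reflect (s - 3)).eval w • LinearMap.toMatrix' (A j)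
  holo₀ k l := by
    simp only [Matrix.sum_apply, Matrix.smul_apply, smul_eq_mul]
    fun_prop
  holoInf k l := by
    simp only [Matrix.sum_apply, Matrix.smul_apply, smul_eq_mul]
    fun_prop
  compat z hz := by
    simp only [twist, Matrix.mul_smul, Matrix.smul_mul, Matrix.mul_one, Matrix.one_mul,
      Finset.smul_sum, smul_smul]
    refine Finset.sum_congr rfl fun j _ => ?_
    have hs : 3 ≤ s := by have := j.2; omega
    congr 1
    rw [← reflect_eval (b j : Polynomial ℂ) (b j).2 hs z hz]
    have h := polesInf_inv x z hz
    have h3 : z ^ s = z ^ (s - 3) * z ^ 3 := by rw [← pow_add]; congr 1; omega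
    have h4 : z ^ (-(-a)) = z ^ (-(-a + 1)) * z := by
      rw [← zpow_add_one₀ hz]; congr 1; ring
    rw [h4]
    rw [h3] at h
    have h5 : poles₀ x z * -(z ^ 2)⁻¹ * (-transConst x) = polesInf x z⁻¹ * z ^ (s - 3) * z := by
      have hz2 : (z ^ 2) ≠ 0 := pow_ne_zero 2 hz
      generalize polesInf x z⁻¹ = y at h
      field_simp
      linear_combination -h
    linear_combination (((b j : Polynomial ℂ).reflect (s - 3)).eval z⁻¹ * z ^ (-(-a + 1))) * h5

/-- The parabolic `SU(p,q)` Higgs bundle `(U ⊕ V, γ_A ⊕ 0)` with `U = ℂ^p ⊗ 𝒪(-a+1)`,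
`V = ℂ^q ⊗ 𝒪(-a)` and the trivial flags of weights `α j`, `β j` over the puncture `x j`. -/
def higgsOf {p q s : ℕ} (x : Fin s → OnePoint ℂ) (a : ℤ) (α β : Fin s → ℝ)
    (hW : ConstWeights p q s a α β)
    (b : Module.Basis (Fin (s - 2)) ℂ (Polynomial.degreeLT ℂ (s - 2)))
    (A : Fin (s - 2) → (Fin p → ℂ) →ₗ[ℂ] (Fin q → ℂ)) : SUHiggsBundle x p q where
  U := constPar x p (-a + 1) α hW.α_nonneg hW.α_lt_one
  V := constPar x q (-a) β hW.β_nonneg hW.β_lt_one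
  γ := gammaA x a b A
  δ := LogHom.zero x _ _
  γ_parabolic := by
    intro j t
    simp only [constPar, constFlag_after]
    by_cases h : t < β j
    · simp [h]
    · have : ¬ t ≤ α j := fun h' => h (lt_of_le_of_lt h' (hW.lt j))
      simp [constFlag, this]
  δ_parabolic := by
    intro j t
    have : ∀ y, (LogHom.zero x (constPar x q (-a) β hW.β_nonneg hW.β_lt_one).toHolBundle
        (constPar x p (-a + 1) α hW.α_nonneg hW.α_lt_one).toHolBundle).fibreMap y = 0 := by
      intro y
      induction y using OnePoint.rec <;> simp [LogHom.fibreMap, LogHom.zero]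
    rw [this]
    simp
  det_weights := by
    intro j
    obtain ⟨k, hk⟩ := hW.integral j
    exact ⟨k, by simp only [constPar, constFlag_totalWeight, hk]⟩
  det_degree := by
    rw [constPar_parDegree, constPar_parDegree]
    push_cast
    linarith [hW.degree_zero]

end ParHiggs

end

/-!
Some maximal minor of the inclusion of a sub-bundle of rank `m` into `ℂ^r ⊗ 𝒪(n)` is not identically
zero, and by the argument principle the degree of the sub-bundle is `m * n - d`, where `d` is the
number of zeros of this minor on the sphere. If `d = 0`, then normalizing by the minor makes the
inclusion matrix entire and bounded, hence constant by Liouville. So a non-constant sub-bundle loses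
at least `1` in degree against a constant one of the same rank. By the lower bound on `ε` every
constant `U' ⊕ V'` has parabolic degree less than `1`, except `U ⊕ 0`, which is the only sub-bundle
of its ranks; so only constant invariant sub-bundles can violate (semi)stability. As the `b_j` are
linearly independent, these are the pairs `(U', V')` of the linear algebra condition.
-/

noncomputable section

namespace ParHiggs

section Entire

open Filter Metric Topology

theorem exists_eq_sub_pow_mul {f : ℂ → ℂ} (hf : Differentiable ℂ f) {z₀ : ℂ} (h0 : f z₀ ≠ 0)
    (c : ℂ) : ∃ (n : ℕ) (g : ℂ → ℂ),
      Differentiable ℂ g ∧ g c ≠ 0 ∧ ∀ z, f z = (z - c) ^ n * g z := by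
  have hdslope : ∀ n, Differentiable ℂ ((Function.swap dslope c)^[n] f) := by
    intro n
    induction n with
    | zero => exact hf
    | succ n ih =>
      rw [Function.iterate_succ_apply', ← differentiableOn_univ]
      exact (Complex.differentiableOn_dslope univ_mem).2 ih.differentiableOn
  obtain ⟨P, hP⟩ := hf.analyticAt c
  have hP0 : P ≠ 0 := by
    rintro rfl
    exact h0 (congrFun (AnalyticOnNhd.eq_of_eventuallyEq (fun z _ => hf.analyticAt z)
      (g := 0) (fun _ _ => analyticAt_const) hP.eventually_eq_zero) z₀)
  exact ⟨P.order, _, hdslope P.order, hP.iterate_dslope_fslope_ne_zero hP0,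
    hP.eq_pow_order_mul_iterate_dslope⟩

theorem finite_inter_zeros {f : ℂ → ℂ} (hf : Differentiable ℂ f) {z₀ : ℂ} (h0 : f z₀ ≠ 0)
    {K : Set ℂ} (hK : IsCompact K) : (K ∩ f ⁻¹' {0}).Finite := by
  have hdisc : f ⁻¹' {0}ᶜ ∈ codiscrete ℂ :=
    AnalyticOnNhd.preimage_zero_mem_codiscrete (fun z _ => hf.analyticAt z) h0
  simpa [Set.sdiff_eq] using
    hK.finite_sdiff_of_mem_codiscreteWithin (codiscreteWithin_mono (Set.subset_univ K) hdisc)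

theorem exists_eq_sub_pow_mul_of_apply_eq_zero {f : ℂ → ℂ} (hf : Differentiable ℂ f) {z₀ : ℂ}
    (h0 : f z₀ ≠ 0) {c : ℂ} (hc : f c = 0) : ∃ (n : ℕ) (g : ℂ → ℂ), n ≠ 0 ∧ Differentiable ℂ g ∧
      (∀ z, f z = (z - c) ^ n * g z) ∧ g ⁻¹' {0} = f ⁻¹' {0} \ {c} := by
  obtain ⟨n, g, hg, hgc, hfg⟩ := exists_eq_sub_pow_mul hf h0 c
  have hn : n ≠ 0 := by
    rintro rfl
    exact hgc (by simpa [hfg c] using hc)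
  refine ⟨n, g, hn, hg, hfg, Set.ext fun z => ?_⟩
  rcases eq_or_ne z c with rfl | hzc
  · simp [hgc]
  · simp [hfg, hzc, sub_eq_zero]

theorem analyticOnNhd_logDeriv {f : ℂ → ℂ} {K : Set ℂ} (hf : AnalyticOnNhd ℂ f K)
    (h0 : ∀ z ∈ K, f z ≠ 0) : AnalyticOnNhd ℂ (logDeriv f) K :=
  fun z hz => (hf z hz).deriv.div (hf z hz) (h0 z hz)

theorem circleIntegral_logDeriv_mul {f g : ℂ → ℂ} {w : ℂ} {R : ℝ} (hR : 0 ≤ R)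
    (hf : AnalyticOnNhd ℂ f (sphere w R)) (hg : AnalyticOnNhd ℂ g (sphere w R))
    (hf0 : ∀ z ∈ sphere w R, f z ≠ 0) (hg0 : ∀ z ∈ sphere w R, g z ≠ 0) :
    (∮ z in C(w, R), logDeriv (fun z => f z * g z) z)
      = (∮ z in C(w, R), logDeriv f z) + ∮ z in C(w, R), logDeriv g z := by
  rw [← circleIntegral.integral_add
    ((analyticOnNhd_logDeriv hf hf0).continuousOn.circleIntegrable hR)
    ((analyticOnNhd_logDeriv hg hg0).continuousOn.circleIntegrable hR)]
  exact circleIntegral.integral_congr hR fun z hz => logDeriv_mul z (hf0 z hz) (hg0 z hz)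
    (hf z hz).differentiableAt (hg z hz).differentiableAt

theorem circleIntegral_logDeriv_sub_zpow {c w : ℂ} {R : ℝ} (hc : c ∈ ball w R) (k : ℤ) :
    (∮ z in C(w, R), logDeriv (fun z => (z - c) ^ k) z) = k * (2 * Real.pi * Complex.I) := by
  have hlog : ∀ z, logDeriv (fun z => (z - c) ^ k) z = k * (z - c)⁻¹ := by
    intro z
    rw [logDeriv_fun_zpow (by fun_prop), logDeriv_apply, deriv_sub_const, deriv_id'', one_div]
  simp only [hlog, circleIntegral.integral_const_mul,
    circleIntegral.integral_sub_inv_of_mem_ball hc]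

theorem circleIntegral_logDeriv_eq_zero {f : ℂ → ℂ} {w : ℂ} {R : ℝ} (hR : 0 ≤ R)
    (hf : AnalyticOnNhd ℂ f (closedBall w R)) (h0 : ∀ z ∈ closedBall w R, f z ≠ 0) :
    (∮ z in C(w, R), logDeriv f z) = 0 := by
  have hlog := analyticOnNhd_logDeriv hf h0
  exact Complex.circleIntegral_eq_zero_of_differentiable_on_off_countable hR Set.countable_empty
    hlog.continuousOn fun z hz => (hlog z (ball_subset_closedBall hz.1)).differentiableAt

theorem exists_circleIntegral_logDeriv_eq {f : ℂ → ℂ} (hf : Differentiable ℂ f) {w : ℂ} {R : ℝ}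
    (hR : 0 < R) (hfR : ∀ z ∈ sphere w R, f z ≠ 0) :
    ∃ N : ℕ, (∮ z in C(w, R), logDeriv f z) = N * (2 * Real.pi * Complex.I) ∧
      (N = 0 ↔ ∀ z ∈ ball w R, f z ≠ 0) := by
  obtain ⟨z₀, hz₀⟩ := (NormedSpace.sphere_nonempty (x := w)).2 hR.le
  have hfin : (ball w R ∩ f ⁻¹' {0}).Finite :=
    (finite_inter_zeros hf (hfR z₀ hz₀) (isCompact_closedBall w R)).subset
      (Set.inter_subset_inter_left _ ball_subset_closedBall)
  induction hZ : hfin.toFinset using Finset.induction_on generalizing f with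
  | empty =>
    have hball : ∀ z ∈ ball w R, f z ≠ 0 := fun z hz h0 =>
      Finset.notMem_empty z (hZ ▸ hfin.mem_toFinset.2 ⟨hz, h0⟩)
    refine ⟨0, ?_, iff_of_true rfl hball⟩
    rw [Nat.cast_zero, zero_mul]
    refine circleIntegral_logDeriv_eq_zero hR.le (fun z _ => hf.analyticAt z) fun z hz => ?_
    rw [← ball_union_sphere] at hz
    exact hz.elim (hball z) (hfR z)
  | insert c Z hcZ ih =>
    obtain ⟨hc, hfc⟩ := hfin.mem_toFinset.1 (hZ ▸ Finset.mem_insert_self c Z)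
    obtain ⟨n, g, hn, hg, hfg, hzeros⟩ :=
      exists_eq_sub_pow_mul_of_apply_eq_zero hf (hfR z₀ hz₀) hfc
    have hgR : ∀ z ∈ sphere w R, g z ≠ 0 := fun z hz h0 => hfR z hz (by rw [hfg, h0, mul_zero])
    have hgZ : ball w R ∩ g ⁻¹' {0} = Z := by
      rw [hzeros, ← Set.inter_sdiff_assoc, ← hfin.coe_toFinset, hZ, Finset.coe_insert,
        Set.insert_sdiff_self_of_notMem (by exact_mod_cast hcZ)]
    obtain ⟨N, hN, -⟩ := ih hg hgR (hgZ ▸ Z.finite_toSet) (by simp [hgZ])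
    refine ⟨n + N, ?_, iff_of_false (by omega) fun h => h c hc hfc⟩
    rw [funext hfg, circleIntegral_logDeriv_mul hR.le (fun z _ => by fun_prop)
      (fun z _ => hg.analyticAt z) (fun z hz => left_ne_zero_of_mul (hfg z ▸ hfR z hz)) hgR, hN,
      Nat.cast_add, add_mul]
    simpa using circleIntegral_logDeriv_sub_zpow hc n

theorem circleIntegral_eq_of_differentiableOn_compl {h : ℂ → ℂ} {c : ℂ}
    (hh : DifferentiableOn ℂ h {c}ᶜ) {r R : ℝ} (hr : 0 < r) (hrR : r ≤ R) :
    (∮ z in C(c, R), h z) = ∮ z in C(c, r), h z := by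
  have hne : ∀ z ∈ (ball c r)ᶜ, z ∈ ({c}ᶜ : Set ℂ) := by
    rintro z hz rfl
    exact hz (mem_ball_self hr)
  refine Complex.circleIntegral_eq_of_differentiable_on_annulus_off_countable hr hrR
    Set.countable_empty (hh.continuousOn.mono fun z hz => hne z hz.2) fun z hz => ?_
  exact hh.differentiableAt (isOpen_compl_singleton.mem_nhds
    (hne z fun hzr => hz.1.2 (ball_subset_closedBall hzr)))

theorem circleIntegral_comp_inv (h : ℂ → ℂ) {R : ℝ} (hR : R ≠ 0) :
    (∮ z in C(0, R), (z ^ 2)⁻¹ * h z⁻¹) = ∮ z in C(0, R⁻¹), h z := by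
  set F : ℝ → ℂ := fun θ => deriv (circleMap 0 R⁻¹) θ • h (circleMap 0 R⁻¹ θ) with hF
  have hF_neg : ∀ θ, deriv (circleMap 0 R) θ • (((circleMap 0 R θ) ^ 2)⁻¹ * h (circleMap 0 R θ)⁻¹)
      = F (-θ) := by
    intro θ
    have h0 : circleMap 0 R θ ≠ 0 := circleMap_ne_center hR
    simp only [hF, deriv_circleMap, ← circleMap_zero_inv, smul_eq_mul]
    field_simp
  have hper : Function.Periodic F (2 * Real.pi) := by
    intro θ
    simp only [hF, deriv_circleMap, periodic_circleMap 0 R⁻¹ θ]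
  calc (∮ z in C(0, R), (z ^ 2)⁻¹ * h z⁻¹) = ∫ θ in 0..2 * Real.pi, F (-θ) := by
        simp only [circleIntegral, hF_neg]
    _ = ∫ θ in -(2 * Real.pi)..-0, F θ := intervalIntegral.integral_comp_neg F
    _ = ∫ θ in 0..2 * Real.pi, F θ := by
        simpa using hper.intervalIntegral_add_eq (-(2 * Real.pi)) 0

theorem circleIntegral_logDeriv_comp_inv {g : ℂ → ℂ} (hg : Differentiable ℂ g) {R : ℝ}
    (hR : 0 < R) :
    (∮ z in C(0, R), logDeriv (fun z => g z⁻¹) z) = -∮ z in C(0, R⁻¹), logDeriv g z := by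
  have hlog : ∀ z ∈ sphere (0 : ℂ) R,
      logDeriv (fun z => g z⁻¹) z = -1 * ((z ^ 2)⁻¹ * logDeriv g z⁻¹) := by
    intro z hz
    have hz0 : z ≠ 0 := ne_of_mem_sphere hz hR.ne'
    have := logDeriv_comp (f := g) (g := fun z : ℂ => z⁻¹) (hg z⁻¹) (differentiableAt_inv hz0)
    rw [Function.comp_def] at this
    rw [this, deriv_inv]
    ring
  rw [circleIntegral.integral_congr hR.le hlog, circleIntegral.integral_const_mul,
    circleIntegral_comp_inv _ hR.ne', neg_one_mul]

theorem exists_one_lt_forall_sphere_ne_zero {f : ℂ → ℂ} (hf : Differentiable ℂ f) {z₀ : ℂ}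
    (h0 : f z₀ ≠ 0) : ∃ R : ℝ, 1 < R ∧ ∀ z ∈ sphere (0 : ℂ) R, f z ≠ 0 := by
  have hfin := (finite_inter_zeros hf h0 (isCompact_closedBall 0 2)).image norm
  obtain ⟨R, ⟨h1, h2⟩, hR⟩ := (Set.Ioo_infinite (one_lt_two (α := ℝ))).exists_notMem_finite hfin
  exact ⟨R, h1, fun z hz hfz => hR ⟨z, ⟨sphere_subset_closedBall.trans
    (closedBall_subset_closedBall h2.le) hz, hfz⟩, by simpa using hz⟩⟩

theorem forall_ne_zero_of_eq_mul_comp_inv {u f g : ℂ → ℂ} (hu0 : ∀ z, z ≠ 0 → u z ≠ 0)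
    (hfg : ∀ z, z ≠ 0 → f z = u z * g z⁻¹) {R : ℝ} (hR : 0 < R)
    (hf0 : ∀ z ∈ closedBall 0 R, f z ≠ 0) (hg0 : ∀ w ∈ ball 0 R⁻¹, g w ≠ 0) :
    (∀ z, f z ≠ 0) ∧ ∀ w, g w ≠ 0 := by
  have hf : ∀ z, f z ≠ 0 := by
    intro z
    rcases le_or_gt ‖z‖ R with hz | hz
    · exact hf0 z (by simpa using hz)
    · have hz0 : z ≠ 0 := norm_pos_iff.1 (hR.trans hz)
      rw [hfg z hz0]
      exact mul_ne_zero (hu0 z hz0) (hg0 _ (by simpa using inv_strictAnti₀ hR hz))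
  refine ⟨hf, fun w hw => ?_⟩
  rcases eq_or_ne w 0 with rfl | hw0
  · exact hg0 0 (mem_ball_self (inv_pos.2 hR)) hw
  · exact hf w⁻¹ (by rw [hfg _ (inv_ne_zero hw0), inv_inv, hw, mul_zero])

theorem circleIntegral_logDeriv_of_eq_mul_comp_inv {u f g : ℂ → ℂ}
    (hu : DifferentiableOn ℂ u {0}ᶜ) (hg : Differentiable ℂ g)
    (hfg : ∀ z, z ≠ 0 → f z = u z * g z⁻¹) {R : ℝ} (hR : 0 < R)
    (hfR : ∀ z ∈ sphere (0 : ℂ) R, f z ≠ 0) :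
    (∮ z in C(0, R), logDeriv u z)
      = (∮ z in C(0, R), logDeriv f z) + ∮ w in C(0, R⁻¹), logDeriv g w := by
  have hsphere : ∀ z ∈ sphere (0 : ℂ) R, z ≠ 0 := fun z hz => ne_of_mem_sphere hz hR.ne'
  have hne : ∀ z ∈ sphere (0 : ℂ) R, u z ≠ 0 ∧ g z⁻¹ ≠ 0 := fun z hz =>
    mul_ne_zero_iff.1 (hfg z (hsphere z hz) ▸ hfR z hz)
  have hlog : ∀ z ∈ sphere (0 : ℂ) R, logDeriv f z = logDeriv (fun z => u z * g z⁻¹) z := by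
    intro z hz
    have heq : f =ᶠ[𝓝 z] fun z => u z * g z⁻¹ := by
      filter_upwards [isOpen_compl_singleton.mem_nhds (hsphere z hz)] using hfg
    rw [logDeriv_apply, logDeriv_apply, heq.deriv_eq, heq.eq_of_nhds]
  have hginv : AnalyticOnNhd ℂ (fun z => g z⁻¹) (sphere 0 R) := fun z hz =>
    (hg.analyticAt _).comp (analyticAt_inv (hsphere z hz))
  have hmul := circleIntegral_logDeriv_mul hR.le
    ((hu.analyticOnNhd isOpen_compl_singleton).mono hsphere) hginv
    (fun z hz => (hne z hz).1) fun z hz => (hne z hz).2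
  rw [← circleIntegral.integral_congr hR.le hlog, circleIntegral_logDeriv_comp_inv hg hR] at hmul
  rw [hmul, neg_add_cancel_right]

theorem exists_circleIntegral_logDeriv_eq_of_eq_mul_comp_inv {u f g : ℂ → ℂ}
    (hu : DifferentiableOn ℂ u {0}ᶜ) (hu0 : ∀ z, z ≠ 0 → u z ≠ 0)
    (hf : Differentiable ℂ f) (hg : Differentiable ℂ g) {z₀ : ℂ} (h0 : f z₀ ≠ 0)
    (hfg : ∀ z, z ≠ 0 → f z = u z * g z⁻¹) :
    ∃ N : ℕ, (∮ z in C(0, 1), logDeriv u z) = N * (2 * Real.pi * Complex.I) ∧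
      (N = 0 ↔ (∀ z, f z ≠ 0) ∧ ∀ w, g w ≠ 0) := by
  obtain ⟨R, hR1, hfR⟩ := exists_one_lt_forall_sphere_ne_zero hf h0
  have hR : 0 < R := one_pos.trans hR1
  have hgR : ∀ w ∈ sphere (0 : ℂ) R⁻¹, g w ≠ 0 := by
    intro w hw hgw
    have hw0 : w ≠ 0 := ne_of_mem_sphere hw (inv_ne_zero hR.ne')
    refine hfR w⁻¹ (by simpa [inv_eq_iff_eq_inv] using hw) ?_
    rw [hfg _ (inv_ne_zero hw0), inv_inv, hgw, mul_zero]
  obtain ⟨N₁, hN₁, hN₁0⟩ := exists_circleIntegral_logDeriv_eq hf hR hfR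
  obtain ⟨N₂, hN₂, hN₂0⟩ := exists_circleIntegral_logDeriv_eq hg (inv_pos.2 hR) hgR
  have hlogu : DifferentiableOn ℂ (logDeriv u) {0}ᶜ :=
    (analyticOnNhd_logDeriv (hu.analyticOnNhd isOpen_compl_singleton) hu0).differentiableOn
  refine ⟨N₁ + N₂, ?_, ?_⟩
  · rw [← circleIntegral_eq_of_differentiableOn_compl hlogu one_pos hR1.le,
      circleIntegral_logDeriv_of_eq_mul_comp_inv hu hg hfg hR hfR, hN₁, hN₂, Nat.cast_add, add_mul]
  · rw [Nat.add_eq_zero_iff, hN₁0, hN₂0]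
    refine ⟨fun ⟨hf0, hg0⟩ => forall_ne_zero_of_eq_mul_comp_inv hu0 hfg hR (fun z hz => ?_) hg0,
      fun ⟨hf0, hg0⟩ => ⟨fun z _ => hf0 z, fun w _ => hg0 w⟩⟩
    rw [← ball_union_sphere] at hz
    exact hz.elim (hf0 z) (hfR z)

theorem eq_apply_zero_of_eq_comp_inv {f g : ℂ → ℂ} (hf : Differentiable ℂ f)
    (hg : ContinuousAt g 0) (h : ∀ z, z ≠ 0 → f z = g z⁻¹) (z : ℂ) : f z = g 0 := by
  refine hf.apply_eq_of_tendsto_cocompact z ?_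
  rw [← cobounded_eq_cocompact]
  refine (hg.tendsto.comp (tendsto_inv₀_cobounded (α := ℂ))).congr' ?_
  filter_upwards [Bornology.eventually_ne_cobounded 0] with z hz using (h z hz).symm

end Entire

section Matrix

theorem differentiableAt_det {ι : Type*} [Fintype ι] [DecidableEq ι] {M : ℂ → Matrix ι ι ℂ} {z : ℂ}
    (hM : ∀ i j, DifferentiableAt ℂ (fun z => M z i j) z) :
    DifferentiableAt ℂ (fun z => (M z).det) z := by
  simp only [Matrix.det_apply]
  fun_prop

theorem differentiableAt_matrix_inv {ι : Type*} [Fintype ι] [DecidableEq ι] {M : ℂ → Matrix ι ι ℂ}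
    {z : ℂ} (hM : ∀ i j, DifferentiableAt ℂ (fun z => M z i j) z) (h0 : (M z).det ≠ 0) (i j : ι) :
    DifferentiableAt ℂ (fun z => (M z)⁻¹ i j) z := by
  have hcramer : ∀ z, (M z)⁻¹ i j = (M z).det⁻¹ * ((M z).updateRow j (Pi.single i 1)).det := by
    intro z
    rw [Matrix.inv_def, Matrix.smul_apply, Ring.inverse_eq_inv', smul_eq_mul, Matrix.adjugate_apply]
  simp only [hcramer]
  refine ((differentiableAt_det hM).inv h0).mul (differentiableAt_det fun k l => ?_)
  rcases eq_or_ne k j with rfl | hk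
  · simp
  · simpa [Matrix.updateRow_ne hk] using hM k l

variable {K ι κ : Type*} [Field K] [Fintype κ] [DecidableEq κ]

theorem exists_submatrix_det_ne_zero [Finite ι] {M : Matrix ι κ K}
    (hM : Function.Injective M.mulVecLin) : ∃ S : κ → ι, (M.submatrix S id).det ≠ 0 := by
  have := Fintype.ofFinite ι
  have hrank : Module.finrank K (Submodule.span K (Set.range M.row)) = Fintype.card κ := by
    rw [← Matrix.rank_eq_finrank_span_row, Matrix.rank, LinearMap.finrank_range_of_inj hM,
      Module.finrank_fintype_fun_eq_card]
  obtain ⟨f, hf, -, hli⟩ := Submodule.exists_fun_fin_finrank_span_eq K (Set.range M.row)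
  choose S hS using hf
  let e : κ ≃ Fin (Module.finrank K (Submodule.span K (Set.range M.row))) :=
    Fintype.equivFinOfCardEq hrank.symm
  have hrows : (M.submatrix (S ∘ e) id).row = f ∘ e := funext fun i => hS (e i)
  refine ⟨S ∘ e, ((Matrix.isUnit_iff_isUnit_det _).1 ?_).ne_zero⟩
  rw [← Matrix.linearIndependent_rows_iff_isUnit, hrows]
  exact hli.comp e e.injective

theorem submatrix_det_ne_zero_iff_disjoint {M : Matrix ι κ K} (hM : Function.Injective M.mulVecLin)
    (S : κ → ι) : (M.submatrix S id).det ≠ 0 ↔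
      Disjoint (LinearMap.range M.mulVecLin) (LinearMap.ker (LinearMap.funLeft K K S)) := by
  have hcomp : (M.submatrix S id).mulVecLin = LinearMap.funLeft K K S ∘ₗ M.mulVecLin := rfl
  rw [← isUnit_iff_ne_zero, ← Matrix.isUnit_iff_isUnit_det, ← Matrix.mulVec_injective_iff_isUnit,
    ← Matrix.coe_mulVecLin, injective_iff_map_eq_zero, hcomp, LinearMap.disjoint_ker]
  have hM0 : ∀ v, M.mulVec v = 0 ↔ v = 0 := (injective_iff_map_eq_zero' M.mulVecLin).1 hM
  simp [hM0]

theorem range_mulVecLin_mul_inv (M : Matrix ι κ K) {X : Matrix κ κ K} (hX : X.det ≠ 0) :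
    LinearMap.range (M * X⁻¹).mulVecLin = LinearMap.range M.mulVecLin := by
  rw [Matrix.mulVecLin_mul]
  refine LinearMap.range_comp_of_range_eq_top _ (LinearMap.range_eq_top.2 fun v => ⟨X.mulVec v, ?_⟩)
  simp [Matrix.nonsing_inv_mul X (isUnit_iff_ne_zero.2 hX)]

end Matrix

theorem HolBundle.degree_eq_neg {r : ℕ} {E : HolBundle r} {k : ℝ}
    (h : (∮ z in C(0, 1), logDeriv (fun z => (E.T z).det) z) = k * (2 * Real.pi * Complex.I)) :
    E.degree = -k := by
  rw [HolBundle.degree, h, mul_left_comm, neg_mul,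
    inv_mul_cancel₀ Complex.two_pi_I_ne_zero]
  simp

namespace Subbundle

variable {r m : ℕ} {n : ℤ}

/-- The maximal minor with rows `S` of the inclusion, over the first chart. -/
def minor₀ {E : HolBundle r} (F : Subbundle E m) (S : Fin m → Fin r) (z : ℂ) : ℂ :=
  ((F.incl₀ z).submatrix S id).det

/-- The maximal minor with rows `S` of the inclusion, over the chart around `∞`. -/
def minorInf {E : HolBundle r} (F : Subbundle E m) (S : Fin m → Fin r) (w : ℂ) : ℂ :=
  ((F.inclInf w).submatrix S id).det

/-- The sub-bundle is `W ⊗ 𝒪(n) ⊂ ℂ^r ⊗ 𝒪(n)` for a fixed subspace `W`. The fibres are compared in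
the trivializations of the two charts, which is meaningful because the transition function of
`ℂ^r ⊗ 𝒪(n)` is scalar. -/
def IsConstant (F : Subbundle (twist r n) m) : Prop :=
  ∃ W : Submodule ℂ (Fin r → ℂ), ∀ y, LinearMap.range (F.fibreMap y) = W

theorem rank_le {E : HolBundle r} (F : Subbundle E m) : m ≤ r := by
  simpa using LinearMap.finrank_le_finrank_of_injective (F.inj₀ 0)

theorem finrank_range_fibreMap {E : HolBundle r} (F : Subbundle E m) (y : OnePoint ℂ) :
    Module.finrank ℂ (LinearMap.range (F.fibreMap y)) = m := by
  rw [LinearMap.finrank_range_of_inj (F.fibreMap_injective y), Module.finrank_fin_fun]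

theorem isConstant_of_rank_eq_zero (F : Subbundle (twist r n) 0) : F.IsConstant :=
  ⟨⊥, fun y => Submodule.finrank_eq_zero.1 (F.finrank_range_fibreMap y)⟩

theorem isConstant_of_rank_eq (F : Subbundle (twist r n) r) : F.IsConstant :=
  ⟨⊤, fun y => Submodule.eq_top_of_finrank_eq (by simp [F.finrank_range_fibreMap])⟩

theorem differentiable_minor₀ {E : HolBundle r} (F : Subbundle E m) (S : Fin m → Fin r) :
    Differentiable ℂ (F.minor₀ S) :=
  fun z => differentiableAt_det fun i j => F.holo₀ (S i) j z

theorem differentiable_minorInf {E : HolBundle r} (F : Subbundle E m) (S : Fin m → Fin r) :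
    Differentiable ℂ (F.minorInf S) :=
  fun w => differentiableAt_det fun i j => F.holoInf (S i) j w

theorem minor₀_ne_zero_iff_disjoint {E : HolBundle r} (F : Subbundle E m) (S : Fin m → Fin r)
    (z : ℂ) : F.minor₀ S z ≠ 0 ↔
      Disjoint (LinearMap.range (F.fibreMap z)) (LinearMap.ker (LinearMap.funLeft ℂ ℂ S)) :=
  submatrix_det_ne_zero_iff_disjoint (F.inj₀ z) S

theorem minorInf_zero_ne_zero_iff_disjoint {E : HolBundle r} (F : Subbundle E m)
    (S : Fin m → Fin r) : F.minorInf S 0 ≠ 0 ↔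
      Disjoint (LinearMap.range (F.fibreMap OnePoint.infty))
        (LinearMap.ker (LinearMap.funLeft ℂ ℂ S)) :=
  submatrix_det_ne_zero_iff_disjoint (F.injInf 0) S

theorem compat_twist (F : Subbundle (twist r n) m) {z : ℂ} (hz : z ≠ 0) :
    F.inclInf z⁻¹ * F.bundle.T z = z ^ (-n) • F.incl₀ z := by
  simpa [twist] using F.compat z hz

theorem submatrix_compat_twist (F : Subbundle (twist r n) m) (S : Fin m → Fin r) {z : ℂ}
    (hz : z ≠ 0) :
    (F.inclInf z⁻¹).submatrix S id * F.bundle.T z = z ^ (-n) • (F.incl₀ z).submatrix S id := by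
  have h := congrArg (fun M => Matrix.submatrix M S id) (F.compat_twist hz)
  simpa [Matrix.submatrix_mul _ _ S id id Function.bijective_id, Matrix.submatrix_smul] using h

theorem minor₀_eq (F : Subbundle (twist r n) m) (S : Fin m → Fin r) {z : ℂ} (hz : z ≠ 0) :
    F.minor₀ S z = z ^ (n * m) * (F.bundle.T z).det * F.minorInf S z⁻¹ := by
  have h : F.minorInf S z⁻¹ * (F.bundle.T z).det = z ^ (-(n * m)) * F.minor₀ S z := by
    simpa [minorInf, minor₀, ← zpow_natCast, ← zpow_mul]
      using congrArg Matrix.det (F.submatrix_compat_twist S hz)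
  rw [mul_assoc, mul_comm (F.bundle.T z).det, h, zpow_neg,
    mul_inv_cancel_left₀ (zpow_ne_zero _ hz)]

theorem minor_ne_zero_of_isConstant {F : Subbundle (twist r n) m} (hF : F.IsConstant)
    {S : Fin m → Fin r} {z₀ : ℂ} (h0 : F.minor₀ S z₀ ≠ 0) :
    (∀ z, F.minor₀ S z ≠ 0) ∧ ∀ w, F.minorInf S w ≠ 0 := by
  obtain ⟨W, hW⟩ := hF
  have hdisj : Disjoint W (LinearMap.ker (LinearMap.funLeft ℂ ℂ S)) :=
    hW z₀ ▸ (F.minor₀_ne_zero_iff_disjoint S z₀).1 h0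
  have h₀ : ∀ z, F.minor₀ S z ≠ 0 := fun z =>
    (F.minor₀_ne_zero_iff_disjoint S z).2 ((hW z).symm ▸ hdisj)
  refine ⟨h₀, fun w => ?_⟩
  rcases eq_or_ne w 0 with rfl | hw
  · exact (F.minorInf_zero_ne_zero_iff_disjoint S).2 ((hW OnePoint.infty).symm ▸ hdisj)
  · have h := h₀ w⁻¹
    rw [F.minor₀_eq S (inv_ne_zero hw), inv_inv] at h
    exact right_ne_zero_of_mul h

theorem incl_mul_inv_eq (F : Subbundle (twist r n) m) (S : Fin m → Fin r) {z : ℂ} (hz : z ≠ 0)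
    (h0 : F.minor₀ S z ≠ 0) :
    F.incl₀ z * ((F.incl₀ z).submatrix S id)⁻¹
      = F.inclInf z⁻¹ * ((F.inclInf z⁻¹).submatrix S id)⁻¹ := by
  have hT : IsUnit (F.bundle.T z).det := isUnit_iff_ne_zero.2 (F.bundle.det_ne_zero z hz)
  have hX : IsUnit ((F.incl₀ z).submatrix S id).det := isUnit_iff_ne_zero.2 h0
  have hpow : z ^ (-n) ≠ 0 := zpow_ne_zero _ hz
  have hinv : (z ^ (-n) • (F.incl₀ z).submatrix S id)⁻¹
      = (z ^ (-n))⁻¹ • ((F.incl₀ z).submatrix S id)⁻¹ :=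
    Matrix.inv_smul' _ (Units.mk0 _ hpow) hX
  calc F.incl₀ z * ((F.incl₀ z).submatrix S id)⁻¹
      = z ^ (-n) • F.incl₀ z * (z ^ (-n) • (F.incl₀ z).submatrix S id)⁻¹ := by
        rw [hinv, Matrix.smul_mul, Matrix.mul_smul, smul_smul, mul_inv_cancel₀ hpow, one_smul]
    _ = F.inclInf z⁻¹ * ((F.inclInf z⁻¹).submatrix S id)⁻¹ := by
        rw [← F.compat_twist hz, ← F.submatrix_compat_twist S hz, Matrix.mul_inv_rev,
          ← Matrix.mul_assoc, Matrix.mul_nonsing_inv_cancel_right _ _ hT]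

theorem isConstant_of_minor_ne_zero (F : Subbundle (twist r n) m) (S : Fin m → Fin r)
    (h₀ : ∀ z, F.minor₀ S z ≠ 0) (hInf : F.minorInf S 0 ≠ 0) : F.IsConstant := by
  have hdiff₀ : ∀ i j,
      Differentiable ℂ fun z => (F.incl₀ z * ((F.incl₀ z).submatrix S id)⁻¹) i j := by
    intro i j z
    simp only [Matrix.mul_apply]
    exact DifferentiableAt.fun_sum fun k _ => (F.holo₀ i k z).mul
      (differentiableAt_matrix_inv (fun k l => F.holo₀ (S k) l z) (h₀ z) k j)
  have hdiffInf : ∀ i j,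
      DifferentiableAt ℂ (fun w => (F.inclInf w * ((F.inclInf w).submatrix S id)⁻¹) i j) 0 := by
    intro i j
    simp only [Matrix.mul_apply]
    exact DifferentiableAt.fun_sum fun k _ => (F.holoInf i k 0).mul
      (differentiableAt_matrix_inv (fun k l => F.holoInf (S k) l 0) hInf k j)
  have hconst : ∀ z, F.incl₀ z * ((F.incl₀ z).submatrix S id)⁻¹
      = F.inclInf 0 * ((F.inclInf 0).submatrix S id)⁻¹ := fun z => Matrix.ext fun i j =>
    eq_apply_zero_of_eq_comp_inv (hdiff₀ i j) (hdiffInf i j).continuousAt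
      (fun z hz => by rw [F.incl_mul_inv_eq S hz (h₀ z)]) z
  refine ⟨LinearMap.range (F.inclInf 0).mulVecLin, fun y => ?_⟩
  induction y using OnePoint.rec with
  | infty => rfl
  | coe z =>
    change LinearMap.range (F.incl₀ z).mulVecLin = _
    rw [← range_mulVecLin_mul_inv _ (h₀ z), hconst, range_mulVecLin_mul_inv _ hInf]

theorem exists_degree_eq (F : Subbundle (twist r n) m) :
    ∃ d : ℕ, F.bundle.degree = m * n - d ∧ (d = 0 ↔ F.IsConstant) := by
  obtain ⟨S, hS⟩ := exists_submatrix_det_ne_zero (F.inj₀ 0)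
  have hT : DifferentiableOn ℂ (fun z => (F.bundle.T z).det) {0}ᶜ := fun z hz =>
    (differentiableAt_det fun i j => (F.bundle.holo i j).differentiableAt
      (isOpen_compl_singleton.mem_nhds hz)).differentiableWithinAt
  have hpow : DifferentiableOn ℂ (fun z : ℂ => z ^ (n * m)) {0}ᶜ := fun z hz =>
    (differentiableAt_zpow.2 (Or.inl hz)).differentiableWithinAt
  obtain ⟨d, hd, hd0⟩ := exists_circleIntegral_logDeriv_eq_of_eq_mul_comp_inv (hpow.fun_mul hT)
    (fun z hz => mul_ne_zero (zpow_ne_zero _ hz) (F.bundle.det_ne_zero z hz))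
    (F.differentiable_minor₀ S) (F.differentiable_minorInf S) hS fun z hz => F.minor₀_eq S hz
  refine ⟨d, ?_, hd0.trans ⟨fun h => F.isConstant_of_minor_ne_zero S h.1 (h.2 0),
    fun h => minor_ne_zero_of_isConstant h hS⟩⟩
  have hsphere : Metric.sphere (0 : ℂ) 1 ⊆ {0}ᶜ := fun z hz =>
    Metric.ne_of_mem_sphere hz one_ne_zero
  have hwind := circleIntegral_logDeriv_mul zero_le_one
    ((hpow.analyticOnNhd isOpen_compl_singleton).mono hsphere)
    ((hT.analyticOnNhd isOpen_compl_singleton).mono hsphere)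
    (fun z hz => zpow_ne_zero _ (hsphere hz)) fun z hz => F.bundle.det_ne_zero z (hsphere hz)
  have hzpow := circleIntegral_logDeriv_sub_zpow (Metric.mem_ball_self (x := (0 : ℂ)) one_pos)
    (n * m)
  simp only [sub_zero] at hzpow
  rw [hd, hzpow] at hwind
  rw [HolBundle.degree_eq_neg (k := d - n * m)
    (by push_cast at hwind ⊢; linear_combination -hwind)]
  ring

end Subbundle

section ConstSubbundle

/-- The constant sub-bundle `L(ℂ^m) ⊗ 𝒪(n)` of `ℂ^r ⊗ 𝒪(n)`. -/
def constSubbundle {r m : ℕ} (n : ℤ) (L : (Fin m → ℂ) →ₗ[ℂ] (Fin r → ℂ))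
    (hL : Function.Injective L) : Subbundle (twist r n) m where
  bundle := twist m n
  incl₀ _ := LinearMap.toMatrix' L
  inclInf _ := LinearMap.toMatrix' L
  holo₀ _ _ := differentiable_const _
  holoInf _ _ := differentiable_const _
  compat z _ := by simp [twist]
  inj₀ _ := by rwa [← Matrix.toLin'_apply', Matrix.toLin'_toMatrix']
  injInf _ := by rwa [← Matrix.toLin'_apply', Matrix.toLin'_toMatrix']

theorem constSubbundle_fibreMap {r m : ℕ} (n : ℤ) (L : (Fin m → ℂ) →ₗ[ℂ] (Fin r → ℂ))
    (hL : Function.Injective L) (y : OnePoint ℂ) : (constSubbundle n L hL).fibreMap y = L := by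
  induction y using OnePoint.rec <;> exact Matrix.toLin'_toMatrix' L

theorem exists_subbundle_forall_range_fibreMap_eq {r : ℕ} (n : ℤ) (W : Submodule ℂ (Fin r → ℂ)) :
    ∃ F : Subbundle (twist r n) (Module.finrank ℂ W),
      ∀ y, LinearMap.range (F.fibreMap y) = W := by
  let e := (Module.finBasis ℂ W).equivFun
  refine ⟨constSubbundle n (W.subtype ∘ₗ e.symm.toLinearMap)
    (W.injective_subtype.comp e.symm.injective), fun y => ?_⟩
  rw [constSubbundle_fibreMap, LinearMap.range_comp_of_range_eq_top _ (LinearEquiv.range _),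
    Submodule.range_subtype]

end ConstSubbundle

section ParabolicDegree

theorem constFlag_comap {W W' : Type} [AddCommGroup W] [Module ℂ W] [AddCommGroup W'] [Module ℂ W']
    (c : ℝ) (h0 : 0 ≤ c) (h1 : c < 1) (i : W' →ₗ[ℂ] W) (hi : Function.Injective i) :
    (constFlag W c h0 h1).comap i hi = constFlag W' c h0 h1 := by
  have h : (fun t => ((constFlag W c h0 h1).filt t).comap i) = (constFlag W' c h0 h1).filt := by
    funext t
    by_cases ht : t ≤ c <;> simp [constFlag, ht, LinearMap.ker_eq_bot.2 hi]
  simp only [WeightedFlag.comap, h]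

theorem constPar_induced_parDegree {s : ℕ} (x : Fin s → OnePoint ℂ) {r m : ℕ} {n : ℤ}
    (c : Fin s → ℝ) (h0 : ∀ j, 0 ≤ c j) (h1 : ∀ j, c j < 1) (F : Subbundle (twist r n) m) :
    ((constPar x r n c h0 h1).induced F).parDegree = F.bundle.degree + m * ∑ j, c j := by
  have hflag : ∀ j, (((constPar x r n c h0 h1).induced F).flag j).totalWeight = m * c j := by
    intro j
    rw [← constFlag_totalWeight m (c j) (h0 j) (h1 j)]
    exact congrArg _ (constFlag_comap _ (h0 j) (h1 j) _ (F.fibreMap_injective (x j)))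
  rw [ParBundle.parDegree, Finset.sum_congr rfl fun j _ => hflag j, ← Finset.mul_sum]
  rfl

/-- The parabolic degree of a sub-bundle of `U ⊕ V` of the form `U' ⊕ V'`, with the induced
parabolic structure. -/
def SUHiggsBundle.inducedParDegree {s p q m n : ℕ} {x : Fin s → OnePoint ℂ}
    (H : SUHiggsBundle x p q) (U' : Subbundle H.U.toHolBundle m)
    (V' : Subbundle H.V.toHolBundle n) : ℝ :=
  (H.U.induced U').parDegree + (H.V.induced V').parDegree

/-- The parabolic degree of a constant sub-bundle `U' ⊕ V'` of ranks `m` and `n` in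
`ℂ^p ⊗ 𝒪(-a+1) ⊕ ℂ^q ⊗ 𝒪(-a)` with the weights `(α, β)`. The twist `a` has been eliminated by means
of the normalization that the parabolic degree of the whole bundle is `0`. -/
def constDegree {s : ℕ} (p q : ℕ) (α β : Fin s → ℝ) (m n : ℕ) : ℝ :=
  (1 - ∑ j, (β j - α j)) / (p + q) * (m * q - n * p)

namespace ConstWeights

variable {p q s : ℕ} {a : ℤ} {α β : Fin s → ℝ}

theorem constDegree_eq (hW : ConstWeights p q s a α β) (hp : 0 < p) (m n : ℕ) :
    constDegree p q α β m n
      = (m * ((-a + 1 : ℤ) : ℝ) + m * ∑ j, α j) + (n * ((-a : ℤ) : ℝ) + n * ∑ j, β j) := by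
  have hpq : (p : ℝ) + q ≠ 0 := by positivity
  rw [constDegree, Finset.sum_sub_distrib]
  push_cast
  field_simp
  linear_combination -(m + n : ℝ) * hW.degree_zero

theorem coeff_pos (hW : ConstWeights p q s a α β) (hp : 0 < p) :
    0 < (1 - ∑ j, (β j - α j)) / ((p : ℝ) + q) :=
  div_pos (sub_pos.2 hW.upper) (by positivity)

theorem constDegree_nonpos_iff (hW : ConstWeights p q s a α β) (hp : 0 < p) {m n : ℕ} :
    constDegree p q α β m n ≤ 0 ↔ (q : ℝ) / p * m ≤ n := by
  rw [constDegree, ← not_lt, mul_pos_iff_of_pos_left (hW.coeff_pos hp), not_lt, sub_nonpos,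
    div_mul_eq_mul_div, div_le_iff₀ (by positivity), mul_comm (m : ℝ)]

theorem constDegree_neg_iff (hW : ConstWeights p q s a α β) (hp : 0 < p) {m n : ℕ} :
    constDegree p q α β m n < 0 ↔ (q : ℝ) / p * m < n := by
  rw [constDegree, ← smul_eq_mul, smul_neg_iff_of_pos_left (hW.coeff_pos hp), sub_neg,
    div_mul_eq_mul_div, div_lt_iff₀ (by positivity), mul_comm (m : ℝ)]

theorem constDegree_lt_one (hW : ConstWeights p q s a α β) (hp : 0 < p) {m n : ℕ} (hm : m ≤ p)
    (hmn : ¬(m = p ∧ n = 0)) : constDegree p q α β m n < 1 := by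
  rcases le_or_gt (m * q) (n * p) with hN | hN
  · have hN' : (m * q - n * p : ℝ) ≤ 0 := sub_nonpos.2 (by exact_mod_cast hN)
    exact (mul_nonpos_of_nonneg_of_nonpos (hW.coeff_pos hp).le hN').trans_lt one_pos
  · have hq : 0 < q := Nat.pos_of_mul_pos_left (Nat.zero_lt_of_lt hN)
    have hN' : m * q + p + q ≤ 2 * p * q + n * p := by
      rcases hm.lt_or_eq with hlt | rfl
      · nlinarith
      · have hn : 0 < n := Nat.pos_of_ne_zero fun h => hmn ⟨rfl, h⟩
        nlinarith
    have hN'' : (m * q - n * p : ℝ) ≤ 2 * p * q - p - q := by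
      have : (m * q + p + q : ℝ) ≤ 2 * p * q + n * p := by exact_mod_cast hN'
      linarith
    rw [constDegree, div_mul_eq_mul_div, div_lt_one (by positivity)]
    calc (1 - ∑ j, (β j - α j)) * (m * q - n * p)
        ≤ (1 - ∑ j, (β j - α j)) * (2 * p * q - p - q) :=
          mul_le_mul_of_nonneg_left hN'' (sub_nonneg.2 hW.upper.le)
      _ < p + q := by linarith [hW.lower]

end ConstWeights

end ParabolicDegree

theorem kingStable_iff {p q r : ℕ} {A : Fin r → (Fin p → ℂ) →ₗ[ℂ] (Fin q → ℂ)} (hp : 0 < p) :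
    KingStable A ↔ ∀ (W₁ : Submodule ℂ (Fin p → ℂ)) (W₂ : Submodule ℂ (Fin q → ℂ)),
      (∀ j, W₁.map (A j) ≤ W₂) →
      ¬(Module.finrank ℂ W₁ = 0 ∧ Module.finrank ℂ W₂ = 0) →
      ¬(Module.finrank ℂ W₁ = p ∧ Module.finrank ℂ W₂ = q) →
        (q : ℝ) / p * Module.finrank ℂ W₁ < Module.finrank ℂ W₂ := by
  have hbot : ∀ (W₁ : Submodule ℂ (Fin p → ℂ)) (W₂ : Submodule ℂ (Fin q → ℂ)),
      Module.finrank ℂ W₁ = 0 ∧ Module.finrank ℂ W₂ = 0 ↔ W₁ = ⊥ ∧ W₂ = ⊥ := by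
    simp [Submodule.finrank_eq_zero]
  have htop : ∀ (W₁ : Submodule ℂ (Fin p → ℂ)) (W₂ : Submodule ℂ (Fin q → ℂ)),
      Module.finrank ℂ W₁ = p ∧ Module.finrank ℂ W₂ = q ↔ W₁ = ⊤ ∧ W₂ = ⊤ := by
    simp [Submodule.eq_top_iff_finrank_eq]
  refine ⟨fun ⟨hss, heq⟩ W₁ W₂ hA h0 h1 => (hss W₁ W₂ hA).lt_of_ne fun h => ?_,
    fun h => ⟨fun W₁ W₂ hA => ?_, fun W₁ W₂ hA heq => ?_⟩⟩
  · rw [hbot] at h0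
    rw [htop] at h1
    exact (heq W₁ W₂ hA h.symm).elim h0 h1
  · by_cases h0 : Module.finrank ℂ W₁ = 0 ∧ Module.finrank ℂ W₂ = 0
    · simp [h0.1, h0.2]
    by_cases h1 : Module.finrank ℂ W₁ = p ∧ Module.finrank ℂ W₂ = q
    · rw [h1.1, h1.2, div_mul_cancel₀ _ (by positivity)]
    · exact (h W₁ W₂ hA h0 h1).le
  · rw [← hbot, ← htop]
    by_contra! hne
    exact (h W₁ W₂ hA (fun h0 => hne.1 h0.1 h0.2) fun h1 => hne.2 h1.1 h1.2).ne' heq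

section Higgs

variable {p q s : ℕ} {a : ℤ} {α β : Fin s → ℝ} {x : Fin s → OnePoint ℂ}
  {b : Module.Basis (Fin (s - 2)) ℂ (Polynomial.degreeLT ℂ (s - 2))}
  {A : Fin (s - 2) → (Fin p → ℂ) →ₗ[ℂ] (Fin q → ℂ)}

theorem gammaA_fibreMap_coe (z : ℂ) (v : Fin p → ℂ) :
    (gammaA x a b A).fibreMap z v = ∑ j, (b j : Polynomial ℂ).eval z • A j v := by
  simp [LogHom.fibreMap, gammaA, ← Matrix.toLin'_apply]

theorem gammaA_fibreMap_infty (v : Fin p → ℂ) :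
    (gammaA x a b A).fibreMap OnePoint.infty v
      = -transConst x • ∑ j, ((b j : Polynomial ℂ).reflect (s - 3)).eval 0 • A j v := by
  simp [LogHom.fibreMap, gammaA, ← Matrix.toLin'_apply]

theorem map_le_of_forall_map_gammaA_le {W₁ : Submodule ℂ (Fin p → ℂ)}
    {W₂ : Submodule ℂ (Fin q → ℂ)}
    (h : ∀ z : ℂ, W₁.map ((gammaA x a b A).fibreMap z) ≤ W₂) (j : Fin (s - 2)) :
    W₁.map (A j) ≤ W₂ := by
  rintro _ ⟨v, hv, rfl⟩
  by_contra hA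
  obtain ⟨ℓ, hℓ, hℓW⟩ := Submodule.exists_le_ker_of_notMem hA
  have hsum : ∑ i, ℓ (A i v) • b i = 0 := by
    refine Subtype.ext (Polynomial.funext fun z => ?_)
    have hz : ℓ ((gammaA x a b A).fibreMap z v) = 0 := hℓW (h z ⟨v, hv, rfl⟩)
    simpa [gammaA_fibreMap_coe, Polynomial.eval_finsetSum, mul_comm] using hz
  exact hℓ (Fintype.linearIndependent_iff.1 b.linearIndependent _ hsum j)

theorem forall_map_gammaA_le_iff {W₁ : Submodule ℂ (Fin p → ℂ)} {W₂ : Submodule ℂ (Fin q → ℂ)} :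
    (∀ y, W₁.map ((gammaA x a b A).fibreMap y) ≤ W₂) ↔ ∀ j, W₁.map (A j) ≤ W₂ := by
  refine ⟨fun h => map_le_of_forall_map_gammaA_le fun z => h z, fun h y => ?_⟩
  have hmem : ∀ v ∈ W₁, ∀ j, A j v ∈ W₂ := fun v hv j => h j ⟨v, hv, rfl⟩
  rintro _ ⟨v, hv, rfl⟩
  induction y using OnePoint.rec with
  | infty =>
    rw [gammaA_fibreMap_infty]
    exact W₂.smul_mem _ (W₂.sum_mem fun j _ => W₂.smul_mem _ (hmem v hv j))
  | coe z =>
    rw [gammaA_fibreMap_coe]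
    exact W₂.sum_mem fun j _ => W₂.smul_mem _ (hmem v hv j)

theorem LogHom.zero_fibreMap (E : HolBundle p) (F : HolBundle q) (y : OnePoint ℂ) :
    (LogHom.zero x E F).fibreMap y = 0 := by
  induction y using OnePoint.rec <;> exact Matrix.mulVecLin_zero

variable (hW : ConstWeights p q s a α β)

theorem higgsOf_invariant_iff {m n : ℕ} (U' : Subbundle (twist p (-a + 1)) m)
    (V' : Subbundle (twist q (-a)) n) :
    (higgsOf x a α β hW b A).Invariant U' V' ↔ ∀ y,
      (LinearMap.range (U'.fibreMap y)).map ((gammaA x a b A).fibreMap y)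
        ≤ LinearMap.range (V'.fibreMap y) := by
  refine forall_congr' fun y => and_iff_left ?_
  have hδ : (higgsOf x a α β hW b A).δ.fibreMap y = 0 := LogHom.zero_fibreMap _ _ y
  rw [hδ, Submodule.map_zero]
  exact bot_le

theorem higgsOf_exists_inducedParDegree_eq (hp : 0 < p) {m n : ℕ}
    (U' : Subbundle (twist p (-a + 1)) m) (V' : Subbundle (twist q (-a)) n) :
    ∃ d : ℕ, (higgsOf x a α β hW b A).inducedParDegree U' V' = constDegree p q α β m n - d ∧
      (d = 0 ↔ U'.IsConstant ∧ V'.IsConstant) := by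
  obtain ⟨d₁, hd₁, hconst₁⟩ := U'.exists_degree_eq
  obtain ⟨d₂, hd₂, hconst₂⟩ := V'.exists_degree_eq
  refine ⟨d₁ + d₂, ?_, by rw [Nat.add_eq_zero_iff, hconst₁, hconst₂]⟩
  calc (higgsOf x a α β hW b A).inducedParDegree U' V'
      = (U'.bundle.degree + m * ∑ j, α j) + (V'.bundle.degree + n * ∑ j, β j) :=
        congrArg₂ (· + ·) (constPar_induced_parDegree x α _ _ U')
          (constPar_induced_parDegree x β _ _ V')
    _ = constDegree p q α β m n - (d₁ + d₂ : ℕ) := by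
        rw [hW.constDegree_eq hp, hd₁, hd₂]
        push_cast
        ring

theorem higgsOf_inducedParDegree_of_isConstant (hp : 0 < p) {m n : ℕ}
    {U' : Subbundle (twist p (-a + 1)) m} {V' : Subbundle (twist q (-a)) n}
    (hU : U'.IsConstant) (hV : V'.IsConstant) :
    (higgsOf x a α β hW b A).inducedParDegree U' V' = constDegree p q α β m n := by
  obtain ⟨d, hd, hconst⟩ :=
    higgsOf_exists_inducedParDegree_eq (b := b) (x := x) (A := A) hW hp U' V'
  rw [hd, hconst.2 ⟨hU, hV⟩, Nat.cast_zero, sub_zero]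

theorem higgsOf_inducedParDegree_neg (hp : 0 < p) {m n : ℕ}
    {U' : Subbundle (twist p (-a + 1)) m} {V' : Subbundle (twist q (-a)) n}
    (h : ¬(U'.IsConstant ∧ V'.IsConstant)) :
    (higgsOf x a α β hW b A).inducedParDegree U' V' < 0 := by
  obtain ⟨d, hd, hconst⟩ :=
    higgsOf_exists_inducedParDegree_eq (b := b) (x := x) (A := A) hW hp U' V'
  have hd1 : (1 : ℝ) ≤ d := by
    exact_mod_cast Nat.one_le_iff_ne_zero.2 fun hd0 => h (hconst.1 hd0)
  have hmn : ¬(m = p ∧ n = 0) := by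
    rintro ⟨rfl, rfl⟩
    exact h ⟨U'.isConstant_of_rank_eq, V'.isConstant_of_rank_eq_zero⟩
  linarith [hW.constDegree_lt_one hp U'.rank_le hmn]

theorem higgsOf_forall_invariant_iff (hp : 0 < p) {P : ℕ → ℕ → ℝ → Prop}
    (hP : ∀ m n t, t < 0 → P m n t) :
    (∀ (m n : ℕ) (U' : Subbundle (twist p (-a + 1)) m) (V' : Subbundle (twist q (-a)) n),
      (higgsOf x a α β hW b A).Invariant U' V' →
        P m n ((higgsOf x a α β hW b A).inducedParDegree U' V')) ↔
    ∀ (W₁ : Submodule ℂ (Fin p → ℂ)) (W₂ : Submodule ℂ (Fin q → ℂ)), (∀ j, W₁.map (A j) ≤ W₂) →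
      P (Module.finrank ℂ W₁) (Module.finrank ℂ W₂)
        (constDegree p q α β (Module.finrank ℂ W₁) (Module.finrank ℂ W₂)) := by
  refine ⟨fun h W₁ W₂ hA => ?_, fun h m n U' V' hinv => ?_⟩
  · obtain ⟨U', hU'⟩ := exists_subbundle_forall_range_fibreMap_eq (-a + 1) W₁
    obtain ⟨V', hV'⟩ := exists_subbundle_forall_range_fibreMap_eq (-a) W₂
    have hinv : (higgsOf x a α β hW b A).Invariant U' V' := by
      simpa only [higgsOf_invariant_iff, hU', hV'] using forall_map_gammaA_le_iff.2 hA
    rw [← higgsOf_inducedParDegree_of_isConstant hW hp ⟨W₁, hU'⟩ ⟨W₂, hV'⟩]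
    exact h _ _ U' V' hinv
  · by_cases hconst : U'.IsConstant ∧ V'.IsConstant
    · rw [higgsOf_inducedParDegree_of_isConstant hW hp hconst.1 hconst.2]
      obtain ⟨⟨W₁, hU'⟩, W₂, hV'⟩ := hconst
      have hA : ∀ j, W₁.map (A j) ≤ W₂ := by
        simpa only [higgsOf_invariant_iff, hU', hV', forall_map_gammaA_le_iff] using hinv
      have hm := U'.finrank_range_fibreMap OnePoint.infty
      have hn := V'.finrank_range_fibreMap OnePoint.infty
      rw [hU'] at hm
      rw [hV'] at hn
      exact hm ▸ hn ▸ h W₁ W₂ hA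
    · exact hP _ _ _ (higgsOf_inducedParDegree_neg hW hp hconst)

theorem higgsOf_semistable_iff (hp : 0 < p) :
    (higgsOf x a α β hW b A).Semistable ↔ KingSemistable A :=
  (higgsOf_forall_invariant_iff hW hp (P := fun _ _ t => t ≤ 0) fun _ _ _ ht => ht.le).trans
    (by simp only [hW.constDegree_nonpos_iff hp, KingSemistable])

theorem higgsOf_stable_iff (hp : 0 < p) :
    (higgsOf x a α β hW b A).Stable ↔ KingStable A :=
  (higgsOf_forall_invariant_iff hW hp
    (P := fun m n t => ¬(m = 0 ∧ n = 0) → ¬(m = p ∧ n = q) → t < 0)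
    fun _ _ _ ht _ _ => ht).trans
    (by simp only [hW.constDegree_neg_iff hp, kingStable_iff hp])

end Higgs

end ParHiggs

end

theorem lemmal_general (p q s : ℕ) (hp : 0 < p) (x : Fin s → OnePoint ℂ)
    (a : ℤ) (α β : Fin s → ℝ) (hW : ParHiggs.ConstWeights p q s a α β)
    (b : Module.Basis (Fin (s - 2)) ℂ (Polynomial.degreeLT ℂ (s - 2)))
    (A : Fin (s - 2) → (Fin p → ℂ) →ₗ[ℂ] (Fin q → ℂ)) :
    ((ParHiggs.higgsOf x a α β hW b A).Semistable ↔ ParHiggs.KingSemistable A) ∧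
    ((ParHiggs.higgsOf x a α β hW b A).Stable ↔ ParHiggs.KingStable A) :=
  ⟨ParHiggs.higgsOf_semistable_iff hW hp, ParHiggs.higgsOf_stable_iff hW hp⟩

theorem lemmal (p q s : ℕ) (hp : 0 < p) (hq : 0 < q) (hs : 3 ≤ s)
    (x : Fin s → OnePoint ℂ) (hx : Function.Injective x)
    (a : ℤ) (α β : Fin s → ℝ) (hW : ParHiggs.ConstWeights p q s a α β)
    (b : Module.Basis (Fin (s - 2)) ℂ (Polynomial.degreeLT ℂ (s - 2)))
    (A : Fin (s - 2) → (Fin p → ℂ) →ₗ[ℂ] (Fin q → ℂ)) :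
    ((ParHiggs.higgsOf x a α β hW b A).Semistable ↔ ParHiggs.KingSemistable A) ∧
    ((ParHiggs.higgsOf x a α β hW b A).Stable ↔ ParHiggs.KingStable A) :=
  lemmal_general p q s hp x a α β hW b A
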